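/- Let $V$ be a finite-dimensional Euclidean space and $W\subset O(V)$ a finite real reflection group. Its roots are the unit normals to the hyperplanes fixed by the reflections of $W$. Let $\Delta$ be a system of simple roots, $\Pi$ the corresponding set of positive roots, $S$ the set of simple reflections, and $T$ the set of all reflections of $W$. Let $r:T\to\Pi$ be the bijection sending a reflection to its positive root. Let $\ell$ and $\ell_T$ be the length functions on $W$ with respect to $S$ and $T$. Write $v\le w$ if $\ell_T(w)=\ell_T(v^{-1}w)+\ell_T(v)$. The support $\operatorname{supp}(w)\subset S$ is the set of simple reflections that occur in some reduced expression of $w$. A standard Coxeter element is a product of all the elements of $S$, each taken once, in some order. For a standard Coxeter element $c$, two reflections $t_1,t_2\in T$ are called $c$-noncrossing if $t_1t_2\le c$ or $t_2t_1\le c$. A left descent of $w$ is an $s\in S$ with $\ell(sw)<\ell(w)$. Let $\Phi_{\ge -1}=(-\Delta)\cup\Pi$. For $s\in S$, let $\sigma_s:\Phi_{\ge -1}\to\Phi_{\ge -1}$ be given by $\sigma_s(\alpha)=\alpha$ if $\alpha\in(-\Delta)\setminus\{-r(s)\}$ and $\sigma_s(\alpha)=s(\alpha)$ if $\alpha\in\Pi\cup\{-r(s)\}$.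 **Proposition.** There is a unique family of symmetric binary relations $\|_c$ on $\Phi_{\ge -1}$ (Reading's $c$-compatibility), indexed by the standard Coxeter elements $c$, such that * $\alpha\,\|_c\,\beta$ for all $\alpha,\beta\in-\Delta$; * if $\alpha\in-\Delta$ and $\beta\in\Pi$, then $\alpha\,\|_c\,\beta$ if and only if $r^{-1}(-\alpha)\notin\operatorname{supp}(r^{-1}(\beta))$; * if $s\in S$ is a left descent of $c$, then $\alpha\,\|_c\,\beta$ if and only if $\sigma_s(\alpha)\,\|_{scs}\,\sigma_s(\beta)$, for all $\alpha,\beta\in\Phi_{\ge -1}$. Moreover, for every standard Coxeter element $c$ and all $\alpha,\beta\in\Pi$, one has $\alpha\,\|_c\,\beta$ if and only if $r^{-1}(\alpha)$ and $r^{-1}(\beta)$ are $c$-noncrossing and $\langle\alpha|\beta\rangle\ge 0$. -/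

import Mathlib

open scoped NNReal

namespace CoxeterCluster

/-- The length of `g` with respect to the subset `X` of a group: the least `k` such that `g` is a
product of `k` elements of `X`. (It is only applied to elements that are such products.) -/
noncomputable def wordLength {G : Type*} [Group G] (X : Set G) (g : G) : ℕ :=
  sInf {k | ∃ l : List G, (∀ x ∈ l, x ∈ X) ∧ l.prod = g ∧ l.length = k}

/-- The support of `g`: the elements of `X` that appear in some word of minimal length
for `g`. -/
def support {G : Type*} [Group G] (X : Set G) (g : G) : Set G :=
  {s | ∃ l : List G, (∀ x ∈ l, x ∈ X) ∧ l.prod = g ∧ l.length = wordLength X g ∧ s ∈ l}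

variable {V : Type*} [NormedAddCommGroup V] [InnerProductSpace ℝ V] [FiniteDimensional ℝ V]

/-- The orthogonal reflection in the hyperplane normal to `v`. On positive roots this is the
inverse of the map sending a reflection to its positive root. -/
noncomputable def refl (v : V) : V ≃ₗᵢ[ℝ] V := (ℝ ∙ v)ᗮ.reflection

/-- The roots of `W`: the unit normals of the hyperplanes fixed by the reflections of `W`. -/
def roots (W : Subgroup (V ≃ₗᵢ[ℝ] V)) : Set V := {v | ‖v‖ = 1 ∧ refl v ∈ W}

/-- The set `T` of all reflections of `W`. -/
def reflections (W : Subgroup (V ≃ₗᵢ[ℝ] V)) : Set (V ≃ₗᵢ[ℝ] V) := refl '' roots W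

/-- `W` is a finite real reflection group in the orthogonal group of `V`. -/
structure IsFiniteReflectionGroup (W : Subgroup (V ≃ₗᵢ[ℝ] V)) : Prop where
  finite : (W : Set (V ≃ₗᵢ[ℝ] V)).Finite
  generated : Subgroup.closure (reflections W) = W

/-- `Δ` is a system of simple roots of `W`: a linearly independent set of roots such that
every root is a combination of `Δ` with all coefficients of the same sign. -/
structure IsSimpleSystem (W : Subgroup (V ≃ₗᵢ[ℝ] V)) (Δ : Set V) : Prop where
  subset_roots : Δ ⊆ roots W
  linearIndepOn : LinearIndepOn ℝ id Δ
  nonneg_or_nonpos : ∀ α ∈ roots W,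
    α ∈ Submodule.span ℝ≥0 Δ ∨ -α ∈ Submodule.span ℝ≥0 Δ

/-- The set `S` of simple reflections. -/
def simpleReflections (Δ : Set V) : Set (V ≃ₗᵢ[ℝ] V) := refl '' Δ

/-- The set `Π` of positive roots. -/
def positiveRoots (W : Subgroup (V ≃ₗᵢ[ℝ] V)) (Δ : Set V) : Set V :=
  {α | α ∈ roots W ∧ α ∈ Submodule.span ℝ≥0 Δ}

/-- The almost positive roots `(-Δ) ∪ Π`. -/
def almostPositiveRoots (W : Subgroup (V ≃ₗᵢ[ℝ] V)) (Δ : Set V) : Set V :=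
  {α | -α ∈ Δ} ∪ positiveRoots W Δ

/-- A standard Coxeter element: the product of all the simple reflections, each occurring
once, in some order. -/
def IsStandardCoxeter (Δ : Set V) (c : V ≃ₗᵢ[ℝ] V) : Prop :=
  ∃ l : List (V ≃ₗᵢ[ℝ] V), l.Nodup ∧ (∀ s, s ∈ l ↔ s ∈ simpleReflections Δ) ∧ l.prod = c

/-- The simple reflection `s` is a left descent of `w`. -/
def IsLeftDescent (Δ : Set V) (s w : V ≃ₗᵢ[ℝ] V) : Prop :=
  s ∈ simpleReflections Δ ∧
    wordLength (simpleReflections Δ) (s * w) < wordLength (simpleReflections Δ) w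

/-- The absolute order: `v ≤ w` iff `ℓ_T(w) = ℓ_T(v⁻¹w) + ℓ_T(v)`. -/
def AbsLE (W : Subgroup (V ≃ₗᵢ[ℝ] V)) (v w : V ≃ₗᵢ[ℝ] V) : Prop :=
  wordLength (reflections W) w =
    wordLength (reflections W) (v⁻¹ * w) + wordLength (reflections W) v

/-- The reflections `t₁`, `t₂` are `c`-noncrossing. -/
def Noncrossing (W : Subgroup (V ≃ₗᵢ[ℝ] V)) (c t₁ t₂ : V ≃ₗᵢ[ℝ] V) : Prop :=
  AbsLE W (t₁ * t₂) c ∨ AbsLE W (t₂ * t₁) c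

open Classical in
/-- The map `σ_s` on almost positive roots, for the simple reflection `s = refl δ`: it fixes
every element of `-Δ` other than `-δ`, and acts as `s` on `Π ∪ {-δ}`. -/
noncomputable def sigma (Δ : Set V) (δ α : V) : V :=
  if -α ∈ Δ ∧ α ≠ -δ then α else refl δ α

/-- `R` is a family of symmetric binary relations on the almost positive roots, indexed by the
standard Coxeter elements, that satisfies the three rules defining `c`-compatibility.
The field `dom` says that `R` relates nothing else. -/
structure IsCompatFamily (W : Subgroup (V ≃ₗᵢ[ℝ] V)) (Δ : Set V)
    (R : (V ≃ₗᵢ[ℝ] V) → V → V → Prop) : Prop where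
  dom : ∀ c α β, R c α β →
    IsStandardCoxeter Δ c ∧ α ∈ almostPositiveRoots W Δ ∧ β ∈ almostPositiveRoots W Δ
  symm : ∀ c α β, R c α β → R c β α
  neg_neg : ∀ c, IsStandardCoxeter Δ c → ∀ α β, -α ∈ Δ → -β ∈ Δ → R c α β
  neg_pos : ∀ c, IsStandardCoxeter Δ c → ∀ α β, -α ∈ Δ → β ∈ positiveRoots W Δ →
    (R c α β ↔ refl (-α) ∉ support (simpleReflections Δ) (refl β))
  rotate : ∀ c, IsStandardCoxeter Δ c → ∀ δ ∈ Δ, IsLeftDescent Δ (refl δ) c →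
    ∀ α ∈ almostPositiveRoots W Δ, ∀ β ∈ almostPositiveRoots W Δ,
      (R c α β ↔ R (refl δ * c * refl δ) (sigma Δ δ α) (sigma Δ δ β))

/-- Reading's `c`-compatibility `α ∥_c β`: the family of relations determined by the rules of
`IsCompatFamily` (a definite description, meaningful since there is exactly one such family). -/
noncomputable def Compat (W : Subgroup (V ≃ₗᵢ[ℝ] V)) (Δ : Set V) :
    (V ≃ₗᵢ[ℝ] V) → V → V → Prop :=
  Classical.epsilon (IsCompatFamily W Δ)

end CoxeterCluster

namespace CoxeterCluster

set_option linter.unusedSectionVars false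

variable {V : Type*} [NormedAddCommGroup V] [InnerProductSpace ℝ V] [FiniteDimensional ℝ V]

/-! ### Reflections -/

/-! Write c as a word in Δ. Moving its first letter δ to the end conjugates c by s = `refl δ`, and
every left descent arises this way (`exists_word_of_isLeftDescent`). Uniqueness: follow a positive
root along these rotations. If it never met the first letter, its whole c⁻¹-orbit would consist of
positive roots. The orbit sum is fixed by c, and a product of independent reflections fixes only
vectors orthogonal to all its roots (`IndepList.orthogonal_of_fixed`), so the sum would vanish
although its height is positive. Hence (`rotation_induction`) the root becomes the first letter, σ
sends it into -Δ, and the first two rules decide. Existence: `CompatRel` combines the support rule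
with the claimed description on pairs of positive roots. Conjugation by s preserves noncrossing and
inner products, and s changes only the δ-coordinate, so the work lies in pairs involving δ or -δ.
The support of `refl β` omits s iff β ∈ span(Δ \ {δ}) (`refl_mem_support_iff`). By Carter's lemma
(`IndepList.length_le`) and rotation induction in a parabolic subgroup, a reflection lies below a
Coxeter element of that subgroup iff its root lies in the span (`wordLength_refl_mul_iff`). With c =
s c' and β ≠ δ, noncrossing of δ and β then means that β or sβ lies in span(Δ \ {δ}), and the sign
of ⟨δ, β⟩ separates the two (`noncrossing_head_and_inner_nonpos_iff`). Uniqueness identifies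
`Compat` with `CompatRel`. -/

lemma isometry_mul_apply (g h : V ≃ₗᵢ[ℝ] V) (x : V) : (g * h) x = g (h x) := rfl

lemma isometry_one_apply (x : V) : (1 : V ≃ₗᵢ[ℝ] V) x = x := rfl

lemma refl_apply_of_norm_eq_one {v : V} (hv : ‖v‖ = 1) (x : V) :
    refl v x = x - (2 * inner ℝ v x) • v := by
  rw [refl, Submodule.reflection_orthogonal_apply, Submodule.reflection_singleton_apply]
  simp [hv, mul_smul, ofNat_smul_eq_nsmul]

lemma refl_self (v : V) : refl v v = -v :=
  Submodule.reflection_orthogonalComplement_singleton_eq_neg v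

lemma refl_neg (v : V) : refl (-v) = refl v := by
  have : (ℝ ∙ (-v)) = (ℝ ∙ v) := by
    rw [← Set.neg_singleton, Submodule.span_neg]
  simp only [refl, this]

lemma refl_mul_self (v : V) : refl v * refl v = 1 :=
  Submodule.reflection_mul_reflection _

lemma refl_inv (v : V) : (refl v)⁻¹ = refl v := Submodule.reflection_inv

lemma refl_refl (v x : V) : refl v (refl v x) = x := Submodule.reflection_reflection _ x

lemma refl_mul_cancel_left (v : V) (g : V ≃ₗᵢ[ℝ] V) : refl v * (refl v * g) = g := by
  rw [← mul_assoc, refl_mul_self, one_mul]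

lemma refl_sub_mem_span (v x : V) : refl v x - x ∈ Submodule.span ℝ {v} := by
  rw [refl, Submodule.reflection_orthogonal_apply, Submodule.reflection_singleton_apply,
    Submodule.mem_span_singleton]
  refine ⟨-(2 * (inner ℝ v x / ((‖v‖ : ℝ) ^ 2))), ?_⟩
  simp only [RCLike.ofReal_real_eq_id, id, ← smul_smul, neg_smul, ofNat_smul_eq_nsmul]
  abel

lemma refl_eq_self_iff (v x : V) : refl v x = x ↔ inner ℝ v x = 0 := by
  rw [refl, Submodule.reflection_eq_self_iff, Submodule.mem_orthogonal_singleton_iff_inner_right]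

lemma refl_map (g : V ≃ₗᵢ[ℝ] V) (v : V) : refl (g v) = g * refl v * g⁻¹ := by
  rw [eq_mul_inv_iff_mul_eq]
  ext x
  simp only [isometry_mul_apply]
  simp only [refl, Submodule.reflection_orthogonal_apply, Submodule.reflection_singleton_apply,
    LinearIsometryEquiv.inner_map_map, LinearIsometryEquiv.norm_map]
  simp

lemma refl_refl_apply (u v : V) : refl (refl u v) = refl u * refl v * refl u := by
  rw [refl_map, refl_inv]

/-! ### Products of reflections -/

/-- The product of the reflections in the hyperplanes normal to the vectors of a list. -/
noncomputable def reflProd (l : List V) : V ≃ₗᵢ[ℝ] V := (l.map refl).prod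

@[simp] lemma reflProd_nil : reflProd ([] : List V) = 1 := rfl

@[simp] lemma reflProd_cons (v : V) (l : List V) : reflProd (v :: l) = refl v * reflProd l := by
  simp [reflProd]

@[simp] lemma reflProd_append (l m : List V) : reflProd (l ++ m) = reflProd l * reflProd m := by
  simp [reflProd]

lemma reflProd_map (g : V ≃ₗᵢ[ℝ] V) (l : List V) :
    reflProd (l.map g) = g * reflProd l * g⁻¹ := by
  induction l with
  | nil => simp
  | cons v l ih => rw [List.map_cons, reflProd_cons, ih, refl_map, reflProd_cons]; group

lemma reflProd_reverse (l : List V) : reflProd l.reverse = (reflProd l)⁻¹ := by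
  induction l with
  | nil => simp
  | cons v l ih => simp [ih, refl_inv]

lemma reflProd_sub_mem_span (l : List V) (x : V) :
    reflProd l x - x ∈ Submodule.span ℝ {v | v ∈ l} := by
  induction l with
  | nil => simp
  | cons v l ih =>
    rw [reflProd_cons, isometry_mul_apply]
    have h1 := Submodule.span_mono (R := ℝ) (s := {v}) (t := {w | w ∈ v :: l}) (by simp)
      (refl_sub_mem_span v (reflProd l x))
    have h2 := Submodule.span_mono (R := ℝ) (s := {w | w ∈ l}) (t := {w | w ∈ v :: l})
      (fun w hw => List.mem_cons_of_mem _ hw) ih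
    simpa using add_mem h1 h2

lemma reflProd_apply_of_orthogonal (l : List V) (x : V) (h : ∀ v ∈ l, inner ℝ v x = 0) :
    reflProd l x = x := by
  induction l with
  | nil => simp
  | cons v l ih =>
    rw [reflProd_cons, isometry_mul_apply,
      ih fun w hw => h w (List.mem_cons_of_mem _ hw), refl_eq_self_iff]
    exact h v List.mem_cons_self

/-- The list has no repetitions and its vectors are linearly independent. -/
def IndepList (l : List V) : Prop := l.Nodup ∧ LinearIndepOn ℝ id {v | v ∈ l}

lemma indepList_cons {v : V} {l : List V} :
    IndepList (v :: l) ↔ v ∉ Submodule.span ℝ {w | w ∈ l} ∧ IndepList l := by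
  have hs : {w | w ∈ v :: l} = insert v {w | w ∈ l} := by ext; simp
  rw [IndepList, IndepList, hs, List.nodup_cons]
  constructor
  · rintro ⟨⟨h1, h2⟩, h3⟩
    rw [linearIndepOn_id_insert (by simpa using h1)] at h3
    exact ⟨h3.2, h2, h3.1⟩
  · rintro ⟨h1, h2, h3⟩
    have h4 : v ∉ l := fun h => h1 (Submodule.subset_span h)
    exact ⟨⟨h4, h2⟩, (linearIndepOn_id_insert (by simpa using h4)).2 ⟨h3, h1⟩⟩

lemma IndepList.orthogonal_of_fixed {l : List V} (hl : IndepList l) {x : V}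
    (hx : reflProd l x = x) : ∀ v ∈ l, inner ℝ v x = 0 := by
  induction l with
  | nil => simp
  | cons v l ih =>
    obtain ⟨h1, h2⟩ := indepList_cons.1 hl
    -- The displacement `refl v x - x` lies both on the line of v and in the span of l; independence
    -- makes it zero.
    have h3 : reflProd l x = refl v x := by
      conv_rhs => rw [← hx, reflProd_cons, isometry_mul_apply, refl_refl]
    have h4 := reflProd_sub_mem_span l x
    rw [h3] at h4
    obtain ⟨r, hr⟩ := Submodule.mem_span_singleton.1 (refl_sub_mem_span v x)
    have h5 : r = 0 := by
      by_contra h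
      rw [← hr] at h4
      exact h1 ((Submodule.smul_mem_iff _ h).1 h4)
    have h6 : refl v x = x := by rw [h5, zero_smul] at hr; exact (sub_eq_zero.1 hr.symm)
    intro w hw
    rcases List.mem_cons.1 hw with rfl | hw
    · exact (refl_eq_self_iff _ _).1 h6
    · exact ih h2 (h3.trans h6) w hw

/-- Vectors orthogonal to m are fixed by the common product, hence orthogonal to l; take orthogonal
complements. -/
lemma IndepList.span_le {l m : List V} (hl : IndepList l) (h : reflProd l = reflProd m) :
    Submodule.span ℝ {v | v ∈ l} ≤ Submodule.span ℝ {v | v ∈ m} := by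
  rw [← Submodule.orthogonal_orthogonal (Submodule.span ℝ {v | v ∈ m}), Submodule.span_le]
  intro v hv
  rw [SetLike.mem_coe, Submodule.mem_orthogonal]
  intro x hx
  rw [real_inner_comm]
  refine hl.orthogonal_of_fixed ?_ v hv
  rw [h]
  refine reflProd_apply_of_orthogonal _ _ fun w hw => ?_
  exact (Submodule.mem_orthogonal _ _).1 hx w (Submodule.subset_span hw)

lemma finrank_span_list_le (l : List V) :
    Module.finrank ℝ (Submodule.span ℝ {v | v ∈ l}) ≤ l.length := by
  classical
  have h := finrank_span_finset_le_card (R := ℝ) l.toFinset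
  rw [List.coe_toFinset] at h
  exact h.trans (List.toFinset_card_le l)

lemma IndepList.finrank_span {l : List V} (hl : IndepList l) :
    Module.finrank ℝ (Submodule.span ℝ {v | v ∈ l}) = l.length := by
  classical
  have h := finrank_span_finset_eq_card (R := ℝ) (s := l.toFinset)
    (by rw [List.coe_toFinset]; exact hl.2)
  rw [List.coe_toFinset] at h
  rw [h, List.toFinset_card_of_nodup hl.1]

lemma indepList_of_length_le_finrank {l : List V}
    (h : l.length ≤ Module.finrank ℝ (Submodule.span ℝ {v | v ∈ l})) : IndepList l := by
  induction l with
  | nil => simp [IndepList]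
  | cons v l ih =>
    have hs : {w | w ∈ v :: l} = insert v {w | w ∈ l} := by ext; simp
    rw [hs] at h
    rw [indepList_cons]
    have h2 : Module.finrank ℝ (Submodule.span ℝ (insert v {w | w ∈ l})) ≤
        1 + Module.finrank ℝ (Submodule.span ℝ {w | w ∈ l}) := by
      rw [Submodule.span_insert]
      exact (Submodule.finrank_add_le_finrank_add_finrank _ _).trans
        (Nat.add_le_add_right ((finrank_span_le_card ({v} : Set V)).trans (by simp)) _)
    rw [List.length_cons] at h
    refine ⟨fun hv => ?_, ih (by omega)⟩
    rw [Submodule.span_insert_eq_span hv] at h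
    have := finrank_span_list_le l
    omega

/-- Half of Carter's lemma: a word in independent reflections is shortest, whatever reflections the
other word uses. It controls both ℓ and ℓ_T. -/
lemma IndepList.length_le {l m : List V} (hl : IndepList l) (h : reflProd l = reflProd m) :
    l.length ≤ m.length := by
  rw [← hl.finrank_span]
  exact (Submodule.finrank_mono (hl.span_le h)).trans (finrank_span_list_le m)

/-! ### Word lengths -/

lemma exists_map_refl {A : Set V} {l : List (V ≃ₗᵢ[ℝ] V)} (h : ∀ x ∈ l, x ∈ refl '' A) :
    ∃ m : List V, (∀ v ∈ m, v ∈ A) ∧ m.map refl = l := by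
  induction l with
  | nil => exact ⟨[], by simp⟩
  | cons x l ih =>
    obtain ⟨m, hm, rfl⟩ := ih fun y hy => h y (List.mem_cons_of_mem _ hy)
    obtain ⟨v, hv, rfl⟩ := h x List.mem_cons_self
    exact ⟨v :: m, by simpa [hv] using hm, rfl⟩

lemma wordLength_refl_le {A : Set V} {m : List V} (hm : ∀ v ∈ m, v ∈ A) :
    wordLength (refl '' A) (reflProd m) ≤ m.length := by
  refine Nat.sInf_le ⟨m.map refl, ?_, rfl, by simp⟩
  intro x hx
  obtain ⟨v, hv, rfl⟩ := List.mem_map.1 hx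
  exact ⟨v, hm v hv, rfl⟩

lemma exists_reduced_word {A : Set V} {m : List V} (hm : ∀ v ∈ m, v ∈ A) :
    ∃ l : List V, (∀ v ∈ l, v ∈ A) ∧ reflProd l = reflProd m ∧
      l.length = wordLength (refl '' A) (reflProd m) := by
  obtain ⟨l, hl, h1, h2⟩ := Nat.sInf_mem (s := {k | ∃ l : List (V ≃ₗᵢ[ℝ] V),
    (∀ x ∈ l, x ∈ refl '' A) ∧ l.prod = reflProd m ∧ l.length = k})
    ⟨m.length, m.map refl, by simpa using fun v hv => ⟨v, hm v hv, rfl⟩, rfl, by simp⟩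
  obtain ⟨l, hl', rfl⟩ := exists_map_refl hl
  exact ⟨l, hl', h1, by rwa [List.length_map] at h2⟩

lemma IndepList.wordLength_eq {A : Set V} {l : List V} (hl : IndepList l)
    (hA : ∀ v ∈ l, v ∈ A) : wordLength (refl '' A) (reflProd l) = l.length := by
  obtain ⟨m, -, h1, h2⟩ := exists_reduced_word hA
  exact le_antisymm (wordLength_refl_le hA) (h2 ▸ hl.length_le h1.symm)

/-! ### Coxeter words and their rotations -/

/-- The list contains every element of `A` exactly once, and nothing else. -/
def IsCoxeterWord (A : Set V) (l : List V) : Prop := l.Nodup ∧ ∀ v, v ∈ l ↔ v ∈ A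

lemma IsCoxeterWord.setOf_mem {A : Set V} {l : List V} (h : IsCoxeterWord A l) :
    {v | v ∈ l} = A := Set.ext h.2

lemma IsCoxeterWord.indepList {A : Set V} {l : List V} (h : IsCoxeterWord A l)
    (hA : LinearIndepOn ℝ id A) : IndepList l := ⟨h.1, by rwa [h.setOf_mem]⟩

lemma IsCoxeterWord.perm {A : Set V} {l m : List V} (h : IsCoxeterWord A l) (hm : l.Perm m) :
    IsCoxeterWord A m := ⟨hm.nodup_iff.1 h.1, fun v => hm.mem_iff.symm.trans (h.2 v)⟩

lemma IsCoxeterWord.rotate {A : Set V} {l : List V} {v : V} (h : IsCoxeterWord A (v :: l)) :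
    IsCoxeterWord A (l ++ [v]) := h.perm (List.perm_append_singleton v l).symm

lemma IsCoxeterWord.tail {A : Set V} {l : List V} {v : V} (h : IsCoxeterWord A (v :: l)) :
    IsCoxeterWord (A \ {v}) l := by
  obtain ⟨h1, h2⟩ := h
  rw [List.nodup_cons] at h1
  refine ⟨h1.2, fun w => ?_⟩
  have := h2 w
  rw [List.mem_cons] at this
  rw [Set.mem_sdiff, ← this, Set.mem_singleton_iff]
  constructor
  · exact fun hw => ⟨Or.inr hw, fun h => h1.1 (h ▸ hw)⟩
  · rintro ⟨rfl | hw, h⟩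
    · exact absurd rfl h
    · exact hw

/-- Under repeated rotation of a Coxeter word, every positive vector eventually becomes the first
letter of the word. -/
theorem rotation_induction {A P : Set V} (hA : LinearIndepOn ℝ id A)
    (hP : ∀ β ∈ P, β ∈ Submodule.span ℝ A) (φ : V →ₗ[ℝ] ℝ) (hφ : ∀ β ∈ P, 0 < φ β)
    (hs : ∀ δ ∈ A, ∀ β ∈ P, β ≠ δ → refl δ β ∈ P)
    (hfin : ∀ l : List V, IsCoxeterWord A l → IsOfFinOrder (reflProd l))
    {Q : List V → V → Prop} (base : ∀ l β, IsCoxeterWord A (β :: l) → Q (β :: l) β)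
    (step : ∀ l δ β, IsCoxeterWord A (δ :: l) → β ∈ P → β ≠ δ → Q (l ++ [δ]) (refl δ β) →
      Q (δ :: l) β) (l : List V) (β : V) (hl : IsCoxeterWord A l) (hβ : β ∈ P) : Q l β := by
  by_contra hQ
  -- A counterexample persists when a prefix a is rotated to the end; a full turn replaces β by c⁻¹β
  -- and restores the word.
  have key : ∀ (a b : List V) (β : V), IsCoxeterWord A (a ++ b) → β ∈ P → ¬ Q (a ++ b) β →
      (reflProd a)⁻¹ β ∈ P ∧ ¬ Q (b ++ a) ((reflProd a)⁻¹ β) := by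
    intro a
    induction a with
    | nil => intro b β _ h1 h2; simpa using ⟨h1, h2⟩
    | cons δ a ih =>
      intro b β hw h1 h2
      rw [List.cons_append] at hw h2
      have hne : β ≠ δ := by rintro rfl; exact h2 (base _ _ hw)
      have h3 : ¬ Q (a ++ (b ++ [δ])) (refl δ β) := by
        rw [← List.append_assoc]
        exact fun h => h2 (step _ _ _ hw h1 hne h)
      have h4 := ih (b ++ [δ]) (refl δ β) (by rw [← List.append_assoc]; exact hw.rotate)
        (hs δ ((hw.2 δ).1 List.mem_cons_self) β h1 hne) h3
      simpa [refl_inv] using h4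
  set c := reflProd l with hc
  have h1 : ∀ k : ℕ, (c⁻¹ ^ k) β ∈ P ∧ ¬ Q l ((c⁻¹ ^ k) β) := by
    intro k
    induction k with
    | zero => simpa using ⟨hβ, hQ⟩
    | succ k ih =>
      have := key l [] _ (by simpa using hl) ih.1 (by simpa using ih.2)
      rw [pow_succ', isometry_mul_apply]
      simpa using this
  -- The orbit sum x is fixed by c, so it is both in the span of A and orthogonal to it, while φ is
  -- positive on each summand.
  obtain ⟨m, hm, hcm⟩ := isOfFinOrder_iff_pow_eq_one.1 (hfin l hl).inv
  set x := ∑ k ∈ Finset.range m, (c⁻¹ ^ k) β with hx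
  have h2 : c⁻¹ x = x := by
    have h3 := Finset.sum_range_succ (fun k => (c⁻¹ ^ k) β) m
    rw [Finset.sum_range_succ' (fun k => (c⁻¹ ^ k) β) m, hcm] at h3
    rw [hx, map_sum]
    simp only [pow_succ', isometry_mul_apply, pow_zero] at h3
    exact add_right_cancel h3
  have h3 : c x = x := by
    conv_lhs => rw [← h2]
    rw [← isometry_mul_apply, mul_inv_cancel, isometry_one_apply]
  have h4 : ∀ v ∈ A, inner ℝ v x = 0 := fun v hv =>
    (hl.indepList hA).orthogonal_of_fixed h3 v ((hl.2 v).2 hv)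
  have h5 : x ∈ Submodule.span ℝ A := Submodule.sum_mem _ fun k _ => hP _ (h1 k).1
  have h6 : x ∈ (Submodule.span ℝ A)ᗮ := by
    rw [Submodule.mem_orthogonal]
    intro u hu
    induction hu using Submodule.span_induction with
    | mem v hv => exact h4 v hv
    | zero => simp
    | add u v _ _ hu hv => rw [inner_add_left, hu, hv, add_zero]
    | smul r u _ hu => rw [inner_smul_left, hu, mul_zero]
  have h7 : x = 0 := by
    have := (Submodule.mem_orthogonal _ _).1 h6 x h5
    exact inner_self_eq_zero.1 this
  have h8 : 0 < φ x := by
    rw [hx, map_sum]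
    exact Finset.sum_pos (fun k _ => hφ _ (h1 k).1) ⟨0, by simpa using hm⟩
  rw [h7, map_zero] at h8
  exact lt_irrefl _ h8

/-! ### Coordinates with respect to a linearly independent set -/

lemma exists_coord {A : Set V} (hA : LinearIndepOn ℝ id A) :
    ∃ f : V → V →ₗ[ℝ] ℝ, ∀ a ∈ A, f a a = 1 ∧ ∀ b ∈ A, b ≠ a → f a b = 0 := by
  classical
  -- Coordinates in a basis extending A; the zero form is a default for vectors outside that basis.
  refine ⟨fun a => if ha : a ∈ hA.extend (Set.subset_univ A) then
    (Module.Basis.extend hA).coord ⟨a, ha⟩ else 0, fun a ha => ?_⟩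
  have hs := hA.subset_extend (Set.subset_univ A)
  have hr : ∀ b (hb : b ∈ A),
      (Module.Basis.extend hA).repr b = Finsupp.single ⟨b, hs hb⟩ 1 := by
    intro b hb
    have h := Module.Basis.repr_self (Module.Basis.extend hA) ⟨b, hs hb⟩
    rwa [Module.Basis.extend_apply_self] at h
  beta_reduce
  rw [dif_pos (hs ha)]
  refine ⟨?_, fun b hb hne => ?_⟩
  · rw [Module.Basis.coord_apply, hr a ha, Finsupp.single_eq_same]
  · rw [Module.Basis.coord_apply, hr b hb, Finsupp.single_eq_of_ne]
    simpa [Subtype.ext_iff, eq_comm] using hne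

/-- The linear form that is one at `a` and zero at the other elements of `A`. -/
noncomputable def coord {A : Set V} (hA : LinearIndepOn ℝ id A) (a : V) : V →ₗ[ℝ] ℝ :=
  (exists_coord hA).choose a

section coord

variable {A : Set V} (hA : LinearIndepOn ℝ id A)
include hA

lemma coord_self {a : V} (ha : a ∈ A) : coord hA a a = 1 :=
  ((exists_coord hA).choose_spec a ha).1

lemma coord_of_ne {a b : V} (ha : a ∈ A) (hb : b ∈ A) (h : b ≠ a) : coord hA a b = 0 :=
  ((exists_coord hA).choose_spec a ha).2 b hb h

lemma coord_nonneg {a v : V} (ha : a ∈ A) (hv : v ∈ Submodule.span ℝ≥0 A) :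
    0 ≤ coord hA a v := by
  induction hv using Submodule.span_induction with
  | mem b hb =>
    by_cases h : b = a
    · subst h; rw [coord_self hA ha]; exact zero_le_one
    · rw [coord_of_ne hA ha hb h]
  | zero => simp
  | add u v _ _ hu hv => rw [map_add]; exact add_nonneg hu hv
  | smul r u _ hu =>
    rw [NNReal.smul_def, map_smul]
    exact mul_nonneg r.2 hu

lemma exists_eq_sum_coord {v : V} (hv : v ∈ Submodule.span ℝ A) :
    ∃ t : Finset V, (t : Set V) ⊆ A ∧ v = ∑ a ∈ t, coord hA a v • a := by
  obtain ⟨f, t, ht, -, h⟩ := Submodule.mem_span_iff_exists_finset_subset.1 hv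
  refine ⟨t, ht, ?_⟩
  conv_lhs => rw [← h]
  refine Finset.sum_congr rfl fun a ha => ?_
  rw [← h, map_sum, Finset.sum_eq_single a]
  · rw [map_smul, coord_self hA (ht ha), smul_eq_mul, mul_one]
  · intro b hb hne
    rw [map_smul, coord_of_ne hA (ht ha) (ht hb) hne, smul_zero]
  · exact fun h => absurd ha h

lemma eq_zero_of_coord_eq_zero {v : V} (hv : v ∈ Submodule.span ℝ A)
    (h : ∀ a ∈ A, coord hA a v = 0) : v = 0 := by
  obtain ⟨t, ht, hv'⟩ := exists_eq_sum_coord hA hv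
  rw [hv']
  exact Finset.sum_eq_zero fun a ha => by rw [h a (ht ha), zero_smul]

lemma coord_eq_zero_iff {a v : V} (ha : a ∈ A) (hv : v ∈ Submodule.span ℝ A) :
    coord hA a v = 0 ↔ v ∈ Submodule.span ℝ (A \ {a}) := by
  have h0 : ∀ u ∈ Submodule.span ℝ (A \ {a}), coord hA a u = 0 := by
    intro u hu
    induction hu using Submodule.span_induction with
    | mem b hb => exact coord_of_ne hA ha hb.1 hb.2
    | zero => simp
    | add u v _ _ hu hv => rw [map_add, hu, hv, add_zero]
    | smul r u _ hu => rw [map_smul, hu, smul_zero]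
  refine ⟨fun h => ?_, h0 v⟩
  have hA' : insert a (A \ {a}) = A := by
    rw [Set.insert_sdiff_singleton, Set.insert_eq_of_mem ha]
  rw [← hA', Submodule.mem_span_insert] at hv
  obtain ⟨r, z, hz, rfl⟩ := hv
  rw [map_add, map_smul, coord_self hA ha, h0 z hz, smul_eq_mul, mul_one, add_zero] at h
  rwa [h, zero_smul, zero_add]

end coord

lemma span_nnreal_le {A : Set V} {v : V} (hv : v ∈ Submodule.span ℝ≥0 A) :
    v ∈ Submodule.span ℝ A :=
  Submodule.span_le_restrictScalars ℝ≥0 ℝ A hv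

/-! ### Positive roots -/

section roots

variable {W : Subgroup (V ≃ₗᵢ[ℝ] V)} {Δ : Set V}

lemma map_mem_roots {g : V ≃ₗᵢ[ℝ] V} (hg : g ∈ W) {α : V} (hα : α ∈ roots W) :
    g α ∈ roots W :=
  ⟨by rw [g.norm_map, hα.1], by
    rw [refl_map]; exact W.mul_mem (W.mul_mem hg hα.2) (W.inv_mem hg)⟩

lemma neg_mem_roots {α : V} (hα : α ∈ roots W) : -α ∈ roots W :=
  ⟨by rw [norm_neg, hα.1], by rw [refl_neg]; exact hα.2⟩

lemma ne_zero_of_mem_roots {α : V} (hα : α ∈ roots W) : α ≠ 0 := by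
  rintro rfl
  simpa using hα.1

lemma reflProd_mem {l : List V} (hl : ∀ v ∈ l, v ∈ roots W) : reflProd l ∈ W := by
  refine W.list_prod_mem fun x hx => ?_
  obtain ⟨v, hv, rfl⟩ := List.mem_map.1 hx
  exact (hl v hv).2

lemma IsFiniteReflectionGroup.isOfFinOrder (hW : IsFiniteReflectionGroup W)
    {g : V ≃ₗᵢ[ℝ] V} (hg : g ∈ W) : IsOfFinOrder g := by
  have : Finite W := hW.finite
  exact W.subtype.isOfFinOrder (isOfFinOrder_of_finite (⟨g, hg⟩ : W))

namespace IsSimpleSystem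

variable (hΔ : IsSimpleSystem W Δ)
include hΔ

lemma simple_pos {δ : V} (hδ : δ ∈ Δ) : δ ∈ positiveRoots W Δ :=
  ⟨hΔ.subset_roots hδ, Submodule.subset_span hδ⟩

lemma pos_or_neg {α : V} (hα : α ∈ roots W) :
    α ∈ positiveRoots W Δ ∨ -α ∈ positiveRoots W Δ :=
  (hΔ.nonneg_or_nonpos α hα).imp (fun h => ⟨hα, h⟩) fun h => ⟨neg_mem_roots hα, h⟩

lemma mem_span {α : V} (hα : α ∈ roots W) : α ∈ Submodule.span ℝ Δ := by
  rcases hΔ.nonneg_or_nonpos α hα with h | h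
  · exact span_nnreal_le h
  · exact (Submodule.neg_mem_iff _).1 (span_nnreal_le h)

lemma coord_nonneg {α δ : V} (hα : α ∈ positiveRoots W Δ) (hδ : δ ∈ Δ) :
    0 ≤ coord hΔ.linearIndepOn δ α :=
  CoxeterCluster.coord_nonneg _ hδ hα.2

lemma exists_coord_pos {α : V} (hα : α ∈ positiveRoots W Δ) :
    ∃ δ ∈ Δ, 0 < coord hΔ.linearIndepOn δ α := by
  by_contra! h
  exact ne_zero_of_mem_roots hα.1 (eq_zero_of_coord_eq_zero hΔ.linearIndepOn
    (hΔ.mem_span hα.1) fun a ha => le_antisymm (h a ha) (hΔ.coord_nonneg hα ha))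

lemma pos_of_coord_pos {α δ : V} (hα : α ∈ roots W) (hδ : δ ∈ Δ)
    (h : 0 < coord hΔ.linearIndepOn δ α) : α ∈ positiveRoots W Δ := by
  refine (hΔ.pos_or_neg hα).resolve_right fun h' => ?_
  have := hΔ.coord_nonneg h' hδ
  rw [map_neg] at this
  linarith

lemma neg_notMem_pos {α : V} (hα : α ∈ positiveRoots W Δ) : -α ∉ positiveRoots W Δ := by
  intro h
  obtain ⟨δ, hδ, h'⟩ := hΔ.exists_coord_pos hα
  have := hΔ.coord_nonneg h hδ
  rw [map_neg] at this
  linarith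

lemma refl_apply {δ : V} (hδ : δ ∈ Δ) (x : V) : refl δ x = x - (2 * inner ℝ δ x) • δ :=
  refl_apply_of_norm_eq_one (hΔ.subset_roots hδ).1 x

lemma coord_refl {δ a : V} (hδ : δ ∈ Δ) (ha : a ∈ Δ) (h : a ≠ δ) (x : V) :
    coord hΔ.linearIndepOn a (refl δ x) = coord hΔ.linearIndepOn a x := by
  rw [hΔ.refl_apply hδ, map_sub, map_smul, coord_of_ne _ ha hδ h.symm, smul_zero, sub_zero]

lemma eq_of_mem_span_singleton {α δ : V} (hα : α ∈ positiveRoots W Δ)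
    (hδ : δ ∈ positiveRoots W Δ) (h : α ∈ Submodule.span ℝ {δ}) : α = δ := by
  obtain ⟨r, rfl⟩ := Submodule.mem_span_singleton.1 h
  have h1 := hα.1.1
  rw [norm_smul, hδ.1.1, mul_one, Real.norm_eq_abs] at h1
  rcases eq_or_eq_neg_of_abs_eq h1 with rfl | rfl
  · exact one_smul _ _
  · exact absurd (by simpa using hα) (hΔ.neg_notMem_pos hδ)

/-- A positive root other than δ has a positive coordinate away from δ. The reflection does not
touch it, and one positive coordinate forces positivity. -/
lemma refl_pos {δ β : V} (hδ : δ ∈ Δ) (hβ : β ∈ positiveRoots W Δ) (h : β ≠ δ) :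
    refl δ β ∈ positiveRoots W Δ := by
  have h1 : refl δ β ∈ roots W := map_mem_roots (hΔ.subset_roots hδ).2 hβ.1
  have h2 : ∃ a ∈ Δ, a ≠ δ ∧ 0 < coord hΔ.linearIndepOn a β := by
    by_contra! h2
    refine h (hΔ.eq_of_mem_span_singleton hβ (hΔ.simple_pos hδ) ?_)
    refine Submodule.mem_span_singleton.2 ⟨coord hΔ.linearIndepOn δ β, ?_⟩
    rw [← sub_eq_zero]
    refine eq_zero_of_coord_eq_zero hΔ.linearIndepOn (sub_mem (Submodule.smul_mem _ _
      (Submodule.subset_span hδ)) (hΔ.mem_span hβ.1)) fun a ha => ?_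
    rw [map_sub, map_smul]
    by_cases hne : a = δ
    · subst hne; rw [coord_self _ ha, smul_eq_mul, mul_one, sub_self]
    · rw [coord_of_ne _ ha hδ (Ne.symm hne), le_antisymm (h2 a ha hne) (hΔ.coord_nonneg hβ ha),
        smul_zero, sub_zero]
  obtain ⟨a, ha, hne, h3⟩ := h2
  exact hΔ.pos_of_coord_pos h1 ha (by rwa [hΔ.coord_refl hδ ha hne])

/-- The δ-coordinate of the positive root `refl δ a` is -2⟨δ, a⟩. -/
lemma inner_nonpos {δ a : V} (hδ : δ ∈ Δ) (ha : a ∈ Δ) (h : a ≠ δ) : inner ℝ δ a ≤ 0 := by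
  have h1 := hΔ.coord_nonneg (hΔ.refl_pos hδ (hΔ.simple_pos ha) h) hδ
  rw [hΔ.refl_apply hδ, map_sub, map_smul, coord_self _ hδ, coord_of_ne _ hδ ha h,
    smul_eq_mul] at h1
  linarith

lemma refl_injOn : Set.InjOn refl (positiveRoots W Δ) := by
  intro α hα β hβ h
  refine hΔ.eq_of_mem_span_singleton hα hβ ?_
  have h1 := refl_sub_mem_span β α
  rw [← h, refl_self] at h1
  have h2 : (-2 : ℝ) • α ∈ Submodule.span ℝ {β} := by
    convert! h1 using 1
    rw [neg_smul, two_smul]; abel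
  exact (Submodule.smul_mem_iff _ (by norm_num)).1 h2

lemma finite : Δ.Finite := by
  have := hΔ.linearIndepOn.linearIndependent.finite
  exact Set.toFinite Δ

lemma exists_isCoxeterWord {A : Set V} (hA : A ⊆ Δ) : ∃ l, IsCoxeterWord A l :=
  ⟨(hΔ.finite.subset hA).toFinset.toList, Finset.nodup_toList _, by simp⟩

/-- Rotation induction for the positive roots of the parabolic subgroup generated by `A`. -/
theorem rotation_induction (hW : IsFiniteReflectionGroup W) {A : Set V} (hA : A ⊆ Δ)
    {Q : List V → V → Prop} (base : ∀ l β, IsCoxeterWord A (β :: l) → Q (β :: l) β)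
    (step : ∀ l δ β, IsCoxeterWord A (δ :: l) → β ∈ positiveRoots W Δ → β ≠ δ →
      Q (l ++ [δ]) (refl δ β) → Q (δ :: l) β) (l : List V) (β : V) (hl : IsCoxeterWord A l)
    (hβ : β ∈ positiveRoots W Δ) (hβA : β ∈ Submodule.span ℝ A) : Q l β := by
  -- The positive functional is the height, the sum of all simple coordinates.
  refine CoxeterCluster.rotation_induction (A := A)
    (P := {β | β ∈ positiveRoots W Δ ∧ β ∈ Submodule.span ℝ A}) (hΔ.linearIndepOn.mono hA)
    (fun β hβ => hβ.2) (∑ a ∈ hΔ.finite.toFinset, coord hΔ.linearIndepOn a) ?_ ?_ ?_ base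
    (fun l δ β h1 h2 => step l δ β h1 h2.1) l β hl ⟨hβ, hβA⟩
  · rintro β ⟨hβ, -⟩
    rw [LinearMap.sum_apply]
    obtain ⟨δ, hδ, h⟩ := hΔ.exists_coord_pos hβ
    exact Finset.sum_pos' (fun a ha => hΔ.coord_nonneg hβ (hΔ.finite.mem_toFinset.1 ha))
      ⟨δ, hΔ.finite.mem_toFinset.2 hδ, h⟩
  · rintro δ hδ β ⟨h1, h2⟩ hne
    refine ⟨hΔ.refl_pos (hA hδ) h1 hne, ?_⟩
    have h3 := Submodule.span_mono (Set.singleton_subset_iff.2 hδ) (refl_sub_mem_span δ β)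
    simpa using add_mem h3 h2
  · intro l hl
    exact hW.isOfFinOrder (reflProd_mem fun v hv => hΔ.subset_roots (hA ((hl.2 v).1 hv)))

/-- Each rotation conjugates the reflection by a letter of A, until it is itself a letter. -/
lemma exists_word_refl (hW : IsFiniteReflectionGroup W) {A : Set V} (hA : A ⊆ Δ) {β : V}
    (hβ : β ∈ positiveRoots W Δ) (hβA : β ∈ Submodule.span ℝ A) :
    ∃ m : List V, (∀ v ∈ m, v ∈ A) ∧ reflProd m = refl β := by
  obtain ⟨l, hl⟩ := hΔ.exists_isCoxeterWord hA
  refine hΔ.rotation_induction hW hA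
    (Q := fun _ β => ∃ m : List V, (∀ v ∈ m, v ∈ A) ∧ reflProd m = refl β) ?_ ?_ l β hl hβ hβA
  · intro l β h
    exact ⟨[β], by simpa using (h.2 β).1 List.mem_cons_self, by simp⟩
  · rintro l δ β h - - ⟨m, hm, hm'⟩
    have hδ := (h.2 δ).1 List.mem_cons_self
    refine ⟨δ :: (m ++ [δ]), by simpa [or_imp, forall_and, hδ] using hm, ?_⟩
    rw [reflProd_cons, reflProd_append, hm', refl_refl_apply]
    simp only [reflProd_cons, reflProd_nil, mul_one, mul_assoc, refl_mul_self,
      refl_mul_cancel_left]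

/-- A reflection of a parabolic subgroup lies below its standard Coxeter elements. -/
lemma exists_factorization (hW : IsFiniteReflectionGroup W) {A : Set V} (hA : A ⊆ Δ) {β : V}
    {l : List V} (hl : IsCoxeterWord A l) (hβ : β ∈ positiveRoots W Δ)
    (hβA : β ∈ Submodule.span ℝ A) :
    ∃ m : List V, (∀ v ∈ m, v ∈ roots W) ∧ m.length + 1 = l.length ∧
      reflProd m = refl β * reflProd l := by
  refine hΔ.rotation_induction hW hA
    (Q := fun l β => ∃ m : List V, (∀ v ∈ m, v ∈ roots W) ∧ m.length + 1 = l.length ∧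
      reflProd m = refl β * reflProd l) ?_ ?_ l β hl hβ hβA
  · intro l β h
    exact ⟨l, fun v hv => hΔ.subset_roots (hA ((h.2 v).1 (List.mem_cons_of_mem _ hv))), rfl,
      by rw [reflProd_cons, refl_mul_cancel_left]⟩
  · rintro l δ β h - - ⟨m, hm, hlen, hm'⟩
    have hδ := hΔ.subset_roots (hA ((h.2 δ).1 List.mem_cons_self))
    refine ⟨m.map (refl δ), ?_, by simpa using hlen, ?_⟩
    · intro v hv
      obtain ⟨w, hw, rfl⟩ := List.mem_map.1 hv
      exact map_mem_roots hδ.2 (hm w hw)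
    · rw [reflProd_map, hm', refl_refl_apply]
      simp only [reflProd_cons, reflProd_append, reflProd_nil, mul_one, mul_assoc, refl_mul_self,
        refl_mul_cancel_left, refl_inv]

/-! ### Supports of reflections -/

/-- The exchange condition. -/
lemma exchange (b : List V) (hb : ∀ v ∈ b, v ∈ Δ) (γ : V) (hγ : γ ∈ positiveRoots W Δ)
    (h : (reflProd b)⁻¹ γ ∉ positiveRoots W Δ) :
    ∃ b' : List V, (∀ v ∈ b', v ∈ Δ) ∧ b'.length + 1 = b.length ∧
      reflProd b' = refl γ * reflProd b := by
  induction b generalizing γ with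
  | nil => exact absurd hγ (by simpa using h)
  | cons δ b ih =>
    have hδ := hb δ List.mem_cons_self
    have hb' : ∀ v ∈ b, v ∈ Δ := fun v hv => hb v (List.mem_cons_of_mem _ hv)
    -- A simple reflection makes only its own root negative, so the letter at which γ turns negative
    -- is the one to delete.
    by_cases hne : γ = δ
    · subst hne
      exact ⟨b, hb', rfl, by rw [reflProd_cons, refl_mul_cancel_left]⟩
    · rw [reflProd_cons, mul_inv_rev, refl_inv, isometry_mul_apply] at h
      obtain ⟨b', h1, h2, h3⟩ := ih hb' _ (hΔ.refl_pos hδ hγ hne) h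
      refine ⟨δ :: b', by simpa [hδ] using h1, by simpa using h2, ?_⟩
      rw [reflProd_cons, h3, refl_refl_apply, reflProd_cons]
      simp only [mul_assoc, refl_mul_cancel_left]

lemma coord_reflProd {l : List V} {δ : V} (hδ : δ ∈ Δ) (hl : ∀ v ∈ l, v ∈ Δ \ {δ}) (x : V) :
    coord hΔ.linearIndepOn δ (reflProd l x) = coord hΔ.linearIndepOn δ x := by
  induction l with
  | nil => simp
  | cons v l ih =>
    have hv := hl v List.mem_cons_self
    rw [reflProd_cons, isometry_mul_apply, hΔ.coord_refl hv.1 hδ (Ne.symm hv.2),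
      ih fun w hw => hl w (List.mem_cons_of_mem _ hw)]

/-- Reduced words of elements of a standard parabolic subgroup stay in that subgroup. -/
lemma notMem_reduced_word {l m : List V} {δ : V} (hδ : δ ∈ Δ) (hm : ∀ v ∈ m, v ∈ Δ \ {δ})
    (hl : ∀ v ∈ l, v ∈ Δ) (h : reflProd l = reflProd m)
    (hlen : l.length = wordLength (simpleReflections Δ) (reflProd m)) : δ ∉ l := by
  intro hmem
  obtain ⟨a, b, rfl, ha⟩ := List.eq_append_cons_of_mem hmem
  have ha' : ∀ v ∈ a, v ∈ Δ \ {δ} := fun v hv =>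
    ⟨hl v (List.mem_append_left _ hv), by rintro rfl; exact ha hv⟩
  have hb : ∀ v ∈ b, v ∈ Δ := fun v hv =>
    hl v (List.mem_append_right _ (List.mem_cons_of_mem _ hv))
  have h1 : (reflProd b)⁻¹ δ = -((reflProd m)⁻¹ (reflProd a δ)) := by
    rw [← h, reflProd_append, reflProd_cons, ← isometry_mul_apply]
    have : (reflProd a * (refl δ * reflProd b))⁻¹ * reflProd a = (reflProd b)⁻¹ * refl δ := by
      rw [mul_inv_rev, mul_inv_rev, refl_inv, inv_mul_cancel_right]
    rw [this, isometry_mul_apply, refl_self, map_neg, neg_neg]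
  -- Neither m nor the prefix a before the first δ involves δ, so both preserve the δ-coordinate.
  -- Hence b⁻¹ makes δ negative, and exchange removes a letter of b along with δ, shortening the
  -- word by two.
  have h2 : coord hΔ.linearIndepOn δ ((reflProd m)⁻¹ (reflProd a δ)) = 1 := by
    rw [← reflProd_reverse, hΔ.coord_reflProd hδ (by simpa using hm), hΔ.coord_reflProd hδ ha',
      coord_self _ hδ]
  have h3 : (reflProd b)⁻¹ δ ∉ positiveRoots W Δ := by
    intro h3
    have := hΔ.coord_nonneg h3 hδ
    rw [h1, map_neg, h2] at this
    linarith
  obtain ⟨b', hb1, hb2, hb3⟩ := hΔ.exchange b hb δ (hΔ.simple_pos hδ) h3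
  have h4 : reflProd (a ++ b') = reflProd m := by
    rw [← h, reflProd_append, reflProd_append, hb3, reflProd_cons]
  have h5 := wordLength_refl_le (A := Δ) (m := a ++ b') fun v hv =>
    (List.mem_append.1 hv).elim (fun h => (ha' v h).1) (hb1 v)
  rw [h4] at h5
  change _ = wordLength (refl '' Δ) _ at hlen
  rw [List.length_append, List.length_cons] at hlen
  rw [List.length_append] at h5
  omega

/-- If β lies in the smaller span, `refl β` has a word avoiding δ, hence so do all its reduced
words. Conversely `refl β β - β = -2β` lies in the span of the letters of any word. -/
lemma refl_mem_support_iff (hW : IsFiniteReflectionGroup W) {δ β : V} (hδ : δ ∈ Δ)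
    (hβ : β ∈ positiveRoots W Δ) :
    refl δ ∈ support (simpleReflections Δ) (refl β) ↔ β ∉ Submodule.span ℝ (Δ \ {δ}) := by
  constructor
  · rintro ⟨l, hl, hprod, hlen, hmem⟩ hspan
    obtain ⟨l, hl', rfl⟩ := exists_map_refl hl
    obtain ⟨m, hm, hm'⟩ := hΔ.exists_word_refl hW Set.sdiff_subset hβ hspan
    obtain ⟨v, hv, hvδ⟩ := List.mem_map.1 hmem
    have := hΔ.refl_injOn (hΔ.simple_pos (hl' v hv)) (hΔ.simple_pos hδ) hvδ
    subst this
    refine hΔ.notMem_reduced_word hδ hm hl' (hprod.trans hm'.symm) ?_ hv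
    rw [hm', ← hlen, List.length_map]
  · intro hspan
    obtain ⟨m, hm, hm'⟩ := hΔ.exists_word_refl hW subset_rfl hβ (hΔ.mem_span hβ.1)
    obtain ⟨l, hl, h1, h2⟩ := exists_reduced_word hm
    rw [hm'] at h1 h2
    refine ⟨l.map refl, by simpa using fun v hv => ⟨v, hl v hv, rfl⟩, h1,
      by rw [List.length_map, h2]; rfl, ?_⟩
    by_contra hmem
    refine hspan ?_
    have h3 := reflProd_sub_mem_span l β
    rw [h1, refl_self] at h3
    have h4 : (-2 : ℝ) • β ∈ Submodule.span ℝ (Δ \ {δ}) := by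
      refine Submodule.span_mono (s := {v | v ∈ l}) ?_ ?_
      · intro v hv
        exact ⟨hl v hv, by rintro rfl; exact hmem (List.mem_map_of_mem hv)⟩
      · convert! h3 using 1
        rw [neg_smul, two_smul]; abel
    exact (Submodule.smul_mem_iff _ (by norm_num)).1 h4

end IsSimpleSystem

end roots

/-! ### The absolute order -/

section absolute

variable {W : Subgroup (V ≃ₗᵢ[ℝ] V)}

lemma conj_mem_reflections {g t : V ≃ₗᵢ[ℝ] V} (hg : g ∈ W) (ht : t ∈ reflections W) :
    g * t * g⁻¹ ∈ reflections W := by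
  obtain ⟨v, hv, rfl⟩ := ht
  exact ⟨g v, map_mem_roots hg hv, refl_map g v⟩

lemma wordLength_conj {g : V ≃ₗᵢ[ℝ] V} (hg : g ∈ W) (x : V ≃ₗᵢ[ℝ] V) :
    wordLength (reflections W) (g * x * g⁻¹) = wordLength (reflections W) x := by
  have key : ∀ (g : V ≃ₗᵢ[ℝ] V), g ∈ W → ∀ x : V ≃ₗᵢ[ℝ] V,
      {k | ∃ l : List (V ≃ₗᵢ[ℝ] V), (∀ y ∈ l, y ∈ reflections W) ∧ l.prod = x ∧ l.length = k} ⊆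
      {k | ∃ l : List (V ≃ₗᵢ[ℝ] V), (∀ y ∈ l, y ∈ reflections W) ∧ l.prod = g * x * g⁻¹ ∧
        l.length = k} := by
    rintro g hg x k ⟨l, hl, rfl, rfl⟩
    refine ⟨l.map (MulAut.conj g), ?_, ?_, by simp⟩
    · intro y hy
      obtain ⟨t, ht, rfl⟩ := List.mem_map.1 hy
      exact conj_mem_reflections hg (hl t ht)
    · rw [List.prod_hom, MulAut.conj_apply]
  rw [wordLength, wordLength]
  congr 1
  refine Set.Subset.antisymm ?_ (key g hg x)
  have h := key g⁻¹ (W.inv_mem hg) (g * x * g⁻¹)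
  have h2 : g⁻¹ * (g * x * g⁻¹) * g⁻¹⁻¹ = x := by group
  rwa [h2] at h

lemma absLE_conj {g : V ≃ₗᵢ[ℝ] V} (hg : g ∈ W) (v w : V ≃ₗᵢ[ℝ] V) :
    AbsLE W (g * v * g⁻¹) (g * w * g⁻¹) ↔ AbsLE W v w := by
  have h : (g * v * g⁻¹)⁻¹ * (g * w * g⁻¹) = g * (v⁻¹ * w) * g⁻¹ := by group
  rw [AbsLE, AbsLE, h, wordLength_conj hg, wordLength_conj hg, wordLength_conj hg]

lemma noncrossing_conj {g : V ≃ₗᵢ[ℝ] V} (hg : g ∈ W) (c t u : V ≃ₗᵢ[ℝ] V) :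
    Noncrossing W (g * c * g⁻¹) (g * t * g⁻¹) (g * u * g⁻¹) ↔ Noncrossing W c t u := by
  have h (t u : V ≃ₗᵢ[ℝ] V) : g * t * g⁻¹ * (g * u * g⁻¹) = g * (t * u) * g⁻¹ := by group
  rw [Noncrossing, Noncrossing, h, h, absLE_conj hg, absLE_conj hg]

lemma noncrossing_comm {c t u : V ≃ₗᵢ[ℝ] V} : Noncrossing W c t u ↔ Noncrossing W c u t :=
  or_comm

/-- The product is the identity, which lies below everything; this covers equal roots. -/
lemma noncrossing_self (c : V ≃ₗᵢ[ℝ] V) (v : V) : Noncrossing W c (refl v) (refl v) := by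
  left
  have h : wordLength (reflections W) (1 : V ≃ₗᵢ[ℝ] V) = 0 :=
    Nat.le_zero.1 (wordLength_refl_le (A := roots W) (m := []) (by simp))
  rw [refl_mul_self, AbsLE, inv_one, one_mul, h, add_zero]

lemma absLE_refl_mul_refl_iff {a b : V} (ha : a ∈ roots W) (hb : b ∈ roots W)
    (hab : a ∉ Submodule.span ℝ {b}) (c : V ≃ₗᵢ[ℝ] V) :
    AbsLE W (refl a * refl b) c ↔
      wordLength (reflections W) c = wordLength (reflections W) (refl b * (refl a * c)) + 2 := by
  have h1 : IndepList [a, b] := by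
    rw [indepList_cons, indepList_cons]
    refine ⟨by simpa using hab, ?_, by simp [IndepList]⟩
    simpa using ne_zero_of_mem_roots hb
  have h2 := h1.wordLength_eq (A := roots W) (by simp [ha, hb])
  have h3 : reflProd [a, b] = refl a * refl b := by simp
  rw [h3] at h2
  rw [AbsLE, mul_inv_rev, refl_inv, refl_inv, mul_assoc, show wordLength (reflections W)
    (refl a * refl b) = 2 from h2]

end absolute

/-! ### Standard Coxeter elements: descents and the absolute order -/

section coxeter

variable {W : Subgroup (V ≃ₗᵢ[ℝ] V)} {Δ : Set V}

namespace IsSimpleSystem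

variable (hΔ : IsSimpleSystem W Δ)
include hΔ

lemma isStandardCoxeter_iff {c : V ≃ₗᵢ[ℝ] V} :
    IsStandardCoxeter Δ c ↔ ∃ m, IsCoxeterWord Δ m ∧ reflProd m = c := by
  constructor
  · rintro ⟨l, hl, hmem, rfl⟩
    obtain ⟨m, hm, rfl⟩ := exists_map_refl fun x hx => (hmem x).1 hx
    refine ⟨m, ⟨hl.of_map refl, fun v => ⟨hm v, fun hv => ?_⟩⟩, rfl⟩
    obtain ⟨w, hw, h⟩ := List.mem_map.1 ((hmem (refl v)).2 ⟨v, hv, rfl⟩)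
    rwa [← hΔ.refl_injOn (hΔ.simple_pos (hm w hw)) (hΔ.simple_pos hv) h]
  · rintro ⟨m, hm, rfl⟩
    refine ⟨m.map refl, hm.1.map_on fun v hv w hw h => ?_, fun s => ?_, rfl⟩
    · exact hΔ.refl_injOn (hΔ.simple_pos ((hm.2 v).1 hv)) (hΔ.simple_pos ((hm.2 w).1 hw)) h
    · rw [List.mem_map]
      exact exists_congr fun v => and_congr_left fun _ => hm.2 v

lemma isStandardCoxeter_reflProd {m : List V} (hm : IsCoxeterWord Δ m) :
    IsStandardCoxeter Δ (reflProd m) := hΔ.isStandardCoxeter_iff.2 ⟨m, hm, rfl⟩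

lemma isLeftDescent_head {δ : V} {l : List V} (hl : IsCoxeterWord Δ (δ :: l)) :
    IsLeftDescent Δ (refl δ) (reflProd (δ :: l)) := by
  refine ⟨⟨δ, (hl.2 δ).1 List.mem_cons_self, rfl⟩, ?_⟩
  have h1 := (hl.indepList hΔ.linearIndepOn).wordLength_eq (A := Δ) fun v hv => (hl.2 v).1 hv
  have h2 := wordLength_refl_le (A := Δ) (m := l) fun v hv =>
    (hl.2 v).1 (List.mem_cons_of_mem _ hv)
  rw [List.length_cons] at h1
  rw [simpleReflections, h1, reflProd_cons, refl_mul_cancel_left]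
  omega

/-- A left descent of a standard Coxeter element is the first letter of a word for it. -/
lemma exists_word_of_isLeftDescent {c : V ≃ₗᵢ[ℝ] V} (hc : IsStandardCoxeter Δ c) {δ : V}
    (hδ : δ ∈ Δ) (h : IsLeftDescent Δ (refl δ) c) :
    ∃ l, IsCoxeterWord Δ (δ :: l) ∧ reflProd (δ :: l) = c := by
  obtain ⟨m, hm, rfl⟩ := hΔ.isStandardCoxeter_iff.1 hc
  have hm' := hm.indepList hΔ.linearIndepOn
  have h1 := hm'.wordLength_eq (A := Δ) fun v hv => (hm.2 v).1 hv
  obtain ⟨l, hl, hl1, hl2⟩ := exists_reduced_word (A := Δ) (m := δ :: m)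
    (by simpa [hδ] using fun v hv => (hm.2 v).1 hv)
  have h2 := h.2
  rw [simpleReflections, h1, ← reflProd_cons, ← hl2] at h2
  have h3 : reflProd (δ :: l) = reflProd m := by
    rw [reflProd_cons, hl1, reflProd_cons, refl_mul_cancel_left]
  refine ⟨l, ?_, h3⟩
  -- The word δ :: l is no longer than m but spans at least as much, so it is independent and is a
  -- rearrangement of m.
  have h4 := Submodule.finrank_mono (hm'.span_le h3.symm)
  rw [hm'.finrank_span] at h4
  have h5 : IndepList (δ :: l) :=
    indepList_of_length_le_finrank (le_trans (by simpa using h2) h4)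
  have h6 : (δ :: l).Subperm m := h5.1.subperm fun v hv => by
    rcases List.mem_cons.1 hv with rfl | hv
    · exact (hm.2 _).2 hδ
    · exact (hm.2 _).2 (hl v hv)
  exact hm.perm (h6.perm_of_length_le (hm'.length_le h3.symm)).symm

/-- Outside the span, prepending γ gives an independent word and the length grows. Inside it,
rotation induction gives a factorization with one reflection fewer. -/
lemma wordLength_refl_mul_iff (hW : IsFiniteReflectionGroup W) {A : Set V} (hA : A ⊆ Δ)
    {l : List V} (hl : IsCoxeterWord A l) {γ : V} (hγ : γ ∈ roots W) :
    l.length = wordLength (reflections W) (refl γ * reflProd l) + 1 ↔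
      γ ∈ Submodule.span ℝ A := by
  have hl' := hl.indepList (hΔ.linearIndepOn.mono hA)
  have hroots : ∀ v ∈ l, v ∈ roots W := fun v hv => hΔ.subset_roots (hA ((hl.2 v).1 hv))
  constructor
  · intro h
    by_contra hspan
    have h1 : IndepList (γ :: l) := indepList_cons.2 ⟨by rwa [hl.setOf_mem], hl'⟩
    have h2 := h1.wordLength_eq (A := roots W) (by simpa [hγ] using hroots)
    rw [reflProd_cons, List.length_cons] at h2
    rw [reflections] at h
    omega
  · intro hspan
    obtain ⟨m, hm, hlen, hm'⟩ : ∃ m : List V, (∀ v ∈ m, v ∈ roots W) ∧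
        m.length + 1 = l.length ∧ reflProd m = refl γ * reflProd l := by
      rcases hΔ.pos_or_neg hγ with h | h
      · exact hΔ.exists_factorization hW hA hl h hspan
      · simpa [refl_neg] using hΔ.exists_factorization hW hA hl h (neg_mem hspan)
    obtain ⟨m', -, h1, h2⟩ := exists_reduced_word hm
    have h3 := wordLength_refl_le hm
    have h4 : l.length ≤ (γ :: m').length := hl'.length_le (by
      rw [reflProd_cons, h1, hm', refl_mul_cancel_left])
    rw [List.length_cons] at h4
    rw [← hm', reflections]
    omega

/-- Write c = s c'. Removing sβ-type products from c leaves `refl β * c'` for one order of the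
factors and `refl (refl δ β) * c'` for the other. -/
lemma noncrossing_head_iff (hW : IsFiniteReflectionGroup W) {δ β : V} {l : List V}
    (hl : IsCoxeterWord Δ (δ :: l)) (hβ : β ∈ positiveRoots W Δ) (hne : β ≠ δ) :
    Noncrossing W (reflProd (δ :: l)) (refl δ) (refl β) ↔
      β ∈ Submodule.span ℝ (Δ \ {δ}) ∨ refl δ β ∈ Submodule.span ℝ (Δ \ {δ}) := by
  have hδ : δ ∈ Δ := (hl.2 δ).1 List.mem_cons_self
  have hδ' := hΔ.simple_pos hδ
  have h1 := (hl.indepList hΔ.linearIndepOn).wordLength_eq (A := roots W) fun v hv =>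
    hΔ.subset_roots ((hl.2 v).1 hv)
  change wordLength (reflections W) _ = _ at h1
  rw [Noncrossing, absLE_refl_mul_refl_iff hδ'.1 hβ.1
    (fun h => hne (hΔ.eq_of_mem_span_singleton hδ' hβ h).symm),
    absLE_refl_mul_refl_iff hβ.1 hδ'.1 (fun h => hne (hΔ.eq_of_mem_span_singleton hβ hδ' h)),
    h1, ← hΔ.wordLength_refl_mul_iff hW Set.sdiff_subset hl.tail hβ.1,
    ← hΔ.wordLength_refl_mul_iff hW Set.sdiff_subset hl.tail (map_mem_roots hδ'.1.2 hβ.1),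
    refl_refl_apply, reflProd_cons, refl_mul_cancel_left, List.length_cons]
  simp only [mul_assoc]
  exact or_congr (by omega) (by omega)

lemma inner_nonpos_of_mem_span {δ β : V} (hδ : δ ∈ Δ) (hβ : β ∈ positiveRoots W Δ)
    (h : β ∈ Submodule.span ℝ (Δ \ {δ})) : inner ℝ δ β ≤ 0 := by
  have h0 := (coord_eq_zero_iff hΔ.linearIndepOn hδ (hΔ.mem_span hβ.1)).2 h
  obtain ⟨t, ht, h1⟩ := exists_eq_sum_coord hΔ.linearIndepOn (hΔ.mem_span hβ.1)
  rw [h1, inner_sum]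
  refine Finset.sum_nonpos fun a ha => ?_
  rw [inner_smul_right]
  by_cases hne : a = δ
  · rw [hne, h0, zero_mul]
  · exact mul_nonpos_of_nonneg_of_nonpos (hΔ.coord_nonneg hβ (ht ha))
      (hΔ.inner_nonpos hδ (ht ha) hne)

lemma inner_refl_self {δ : V} (hδ : δ ∈ Δ) (β : V) :
    inner ℝ δ (refl δ β) = -inner ℝ δ β := by
  rw [hΔ.refl_apply hδ, inner_sub_right, inner_smul_right, real_inner_self_eq_norm_sq,
    (hΔ.subset_roots hδ).1]
  ring

/-- Roots in span(Δ \ {δ}) pair nonpositively with δ, and s flips that sign. If sβ is the one in the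
span, then ⟨δ, β⟩ = 0 and sβ = β. -/
lemma noncrossing_head_and_inner_nonpos_iff (hW : IsFiniteReflectionGroup W) {δ β : V}
    {l : List V} (hl : IsCoxeterWord Δ (δ :: l)) (hβ : β ∈ positiveRoots W Δ) (hne : β ≠ δ) :
    (Noncrossing W (reflProd (δ :: l)) (refl δ) (refl β) ∧ inner ℝ δ β ≤ 0) ↔
      β ∈ Submodule.span ℝ (Δ \ {δ}) := by
  have hδ : δ ∈ Δ := (hl.2 δ).1 List.mem_cons_self
  rw [hΔ.noncrossing_head_iff hW hl hβ hne]
  constructor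
  · rintro ⟨h | h, hin⟩
    · exact h
    · have hβ' := hΔ.refl_pos hδ hβ hne
      have h1 := hΔ.inner_nonpos_of_mem_span hδ hβ' h
      rw [hΔ.inner_refl_self hδ] at h1
      have h2 : inner ℝ δ β = 0 := by linarith
      rwa [(refl_eq_self_iff _ _).2 h2] at h
  · exact fun h => ⟨Or.inl h, hΔ.inner_nonpos_of_mem_span hδ hβ h⟩

end IsSimpleSystem

/-! ### The compatibility relation -/

variable (W Δ) in
/-- The explicit description of `c`-compatibility. -/
def CompatRel (c : V ≃ₗᵢ[ℝ] V) (α β : V) : Prop :=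
  IsStandardCoxeter Δ c ∧ α ∈ almostPositiveRoots W Δ ∧ β ∈ almostPositiveRoots W Δ ∧
    (-α ∈ Δ → β ∈ positiveRoots W Δ → refl (-α) ∉ support (simpleReflections Δ) (refl β)) ∧
    (-β ∈ Δ → α ∈ positiveRoots W Δ → refl (-β) ∉ support (simpleReflections Δ) (refl α)) ∧
    (α ∈ positiveRoots W Δ → β ∈ positiveRoots W Δ →
      Noncrossing W c (refl α) (refl β) ∧ 0 ≤ inner ℝ α β)

lemma CompatRel.symm {c : V ≃ₗᵢ[ℝ] V} {α β : V} (h : CompatRel W Δ c α β) :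
    CompatRel W Δ c β α := by
  obtain ⟨h1, h2, h3, h4, h5, h6⟩ := h
  refine ⟨h1, h3, h2, h5, h4, fun hβ hα => ?_⟩
  rw [noncrossing_comm, real_inner_comm]
  exact h6 hα hβ

lemma compatRel_comm {c : V ≃ₗᵢ[ℝ] V} {α β : V} :
    CompatRel W Δ c α β ↔ CompatRel W Δ c β α := ⟨CompatRel.symm, CompatRel.symm⟩

namespace IsSimpleSystem

variable (hΔ : IsSimpleSystem W Δ)
include hΔ

lemma neg_notMem_simple {β : V} (hβ : β ∈ positiveRoots W Δ) : -β ∉ Δ :=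
  fun h => hΔ.neg_notMem_pos hβ (hΔ.simple_pos h)

lemma notMem_pos_of_neg_mem {α : V} (hα : -α ∈ Δ) : α ∉ positiveRoots W Δ :=
  fun h => hΔ.neg_notMem_simple h hα

lemma sigma_neg {δ a : V} (ha : a ∈ Δ) (hne : a ≠ δ) : sigma Δ δ (-a) = -a := by
  rw [sigma, if_pos ⟨by rwa [neg_neg], fun h => hne (neg_injective h)⟩]

lemma sigma_neg_self (δ : V) : sigma Δ δ (-δ) = δ := by
  rw [sigma, if_neg (by simp), map_neg, refl_self, neg_neg]

lemma sigma_pos {β : V} (δ : V) (hβ : β ∈ positiveRoots W Δ) : sigma Δ δ β = refl δ β := by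
  rw [sigma, if_neg fun h => hΔ.neg_notMem_simple hβ h.1]

lemma sigma_self {δ : V} (hδ : δ ∈ Δ) : sigma Δ δ δ = -δ := by
  rw [hΔ.sigma_pos δ (hΔ.simple_pos hδ), refl_self]

lemma sigma_mem {δ β : V} (hδ : δ ∈ Δ) (hβ : β ∈ almostPositiveRoots W Δ) :
    sigma Δ δ β ∈ almostPositiveRoots W Δ := by
  rcases hβ with hβ | hβ
  · by_cases hne : -β = δ
    · rw [← neg_neg β, hne, hΔ.sigma_neg_self]
      exact Or.inr (hΔ.simple_pos hδ)
    · rw [← neg_neg β, hΔ.sigma_neg hβ hne, neg_neg]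
      exact Or.inl hβ
  · by_cases hne : β = δ
    · rw [hne, hΔ.sigma_self hδ]
      exact Or.inl (by simpa using hδ)
    · rw [hΔ.sigma_pos δ hβ]
      exact Or.inr (hΔ.refl_pos hδ hβ hne)

lemma compatRel_neg_neg {c : V ≃ₗᵢ[ℝ] V} (hc : IsStandardCoxeter Δ c) {α β : V}
    (hα : -α ∈ Δ) (hβ : -β ∈ Δ) : CompatRel W Δ c α β :=
  ⟨hc, Or.inl hα, Or.inl hβ, fun _ h => absurd h (hΔ.notMem_pos_of_neg_mem hβ),
    fun _ h => absurd h (hΔ.notMem_pos_of_neg_mem hα),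
    fun h => absurd h (hΔ.notMem_pos_of_neg_mem hα)⟩

lemma compatRel_neg_pos {c : V ≃ₗᵢ[ℝ] V} (hc : IsStandardCoxeter Δ c) {α β : V}
    (hα : -α ∈ Δ) (hβ : β ∈ positiveRoots W Δ) :
    CompatRel W Δ c α β ↔ refl (-α) ∉ support (simpleReflections Δ) (refl β) :=
  ⟨fun h => h.2.2.2.1 hα hβ, fun h => ⟨hc, Or.inl hα, Or.inr hβ, fun _ _ => h,
    fun _ h => absurd h (hΔ.notMem_pos_of_neg_mem hα),
    fun h => absurd h (hΔ.notMem_pos_of_neg_mem hα)⟩⟩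

lemma compatRel_neg_pos' (hW : IsFiniteReflectionGroup W) {c : V ≃ₗᵢ[ℝ] V}
    (hc : IsStandardCoxeter Δ c) {a β : V} (ha : a ∈ Δ) (hβ : β ∈ positiveRoots W Δ) :
    CompatRel W Δ c (-a) β ↔ β ∈ Submodule.span ℝ (Δ \ {a}) := by
  rw [hΔ.compatRel_neg_pos hc (by rwa [neg_neg]) hβ, neg_neg, hΔ.refl_mem_support_iff hW ha hβ,
    not_not]

lemma compatRel_pos_pos {c : V ≃ₗᵢ[ℝ] V} (hc : IsStandardCoxeter Δ c) {α β : V}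
    (hα : α ∈ positiveRoots W Δ) (hβ : β ∈ positiveRoots W Δ) :
    CompatRel W Δ c α β ↔ Noncrossing W c (refl α) (refl β) ∧ 0 ≤ inner ℝ α β :=
  ⟨fun h => h.2.2.2.2.2 hα hβ, fun h => ⟨hc, Or.inr hα, Or.inr hβ,
    fun h => absurd hα (hΔ.notMem_pos_of_neg_mem h),
    fun h => absurd hβ (hΔ.notMem_pos_of_neg_mem h), fun _ _ => h⟩⟩

lemma refl_mem_span_iff {δ a β : V} (hδ : δ ∈ Δ) (ha : a ∈ Δ) (hne : a ≠ δ) (hβ : β ∈ roots W) :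
    refl δ β ∈ Submodule.span ℝ (Δ \ {a}) ↔ β ∈ Submodule.span ℝ (Δ \ {a}) := by
  rw [← coord_eq_zero_iff hΔ.linearIndepOn ha (hΔ.mem_span hβ),
    ← coord_eq_zero_iff hΔ.linearIndepOn ha
      (hΔ.mem_span (map_mem_roots (hΔ.subset_roots hδ).2 hβ)), hΔ.coord_refl hδ ha hne]

lemma rotate_mul {δ : V} (l : List V) :
    refl δ * reflProd (δ :: l) * refl δ = reflProd (l ++ [δ]) := by
  simp [refl_mul_cancel_left]

lemma noncrossing_rotate {δ : V} (hδ : δ ∈ Δ) (c : V ≃ₗᵢ[ℝ] V) (α β : V) :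
    Noncrossing W (refl δ * c * refl δ) (refl (refl δ α)) (refl (refl δ β)) ↔
      Noncrossing W c (refl α) (refl β) := by
  have := noncrossing_conj (hΔ.subset_roots hδ).2 c (refl α) (refl β)
  rw [refl_inv] at this
  rw [← this, refl_refl_apply, refl_refl_apply]

/-! ### Rotation invariance of the explicit relation -/

lemma compatRel_rotate_neg_neg (hW : IsFiniteReflectionGroup W) {c c' : V ≃ₗᵢ[ℝ] V}
    (hc : IsStandardCoxeter Δ c) (hc' : IsStandardCoxeter Δ c') {δ a b : V} (hδ : δ ∈ Δ)
    (ha : a ∈ Δ) (hb : b ∈ Δ) :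
    CompatRel W Δ c (-a) (-b) ↔ CompatRel W Δ c' (sigma Δ δ (-a)) (sigma Δ δ (-b)) := by
  have key : ∀ a ∈ Δ, a ≠ δ → CompatRel W Δ c' (-a) δ := fun a ha hne =>
    (hΔ.compatRel_neg_pos' hW hc' ha (hΔ.simple_pos hδ)).2
      (Submodule.subset_span ⟨hδ, Ne.symm hne⟩)
  refine iff_of_true (hΔ.compatRel_neg_neg hc (by rwa [neg_neg]) (by rwa [neg_neg])) ?_
  by_cases hae : a = δ <;> by_cases hbe : b = δ
  · rw [hae, hbe, hΔ.sigma_neg_self, hΔ.compatRel_pos_pos hc' (hΔ.simple_pos hδ)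
      (hΔ.simple_pos hδ)]
    exact ⟨noncrossing_self _ _, real_inner_self_nonneg⟩
  · rw [hae, hΔ.sigma_neg_self, hΔ.sigma_neg hb hbe]
    exact (key b hb hbe).symm
  · rw [hbe, hΔ.sigma_neg_self, hΔ.sigma_neg ha hae]
    exact key a ha hae
  · rw [hΔ.sigma_neg ha hae, hΔ.sigma_neg hb hbe]
    exact hΔ.compatRel_neg_neg hc' (by rwa [neg_neg]) (by rwa [neg_neg])

lemma compatRel_rotate_neg_pos (hW : IsFiniteReflectionGroup W) {δ a β : V} {l : List V}
    (hl : IsCoxeterWord Δ (δ :: l)) (ha : a ∈ Δ) (hβ : β ∈ positiveRoots W Δ) :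
    CompatRel W Δ (reflProd (δ :: l)) (-a) β ↔
      CompatRel W Δ (refl δ * reflProd (δ :: l) * refl δ) (sigma Δ δ (-a)) (sigma Δ δ β) := by
  have hδ : δ ∈ Δ := (hl.2 δ).1 List.mem_cons_self
  have hc := hΔ.isStandardCoxeter_reflProd hl
  have hc' : IsStandardCoxeter Δ (refl δ * reflProd (δ :: l) * refl δ) := by
    rw [hΔ.rotate_mul]; exact hΔ.isStandardCoxeter_reflProd hl.rotate
  rw [hΔ.compatRel_neg_pos' hW hc ha hβ]
  by_cases hae : a = δ <;> by_cases hβe : β = δ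
  · rw [hae, hβe, hΔ.sigma_neg_self, hΔ.sigma_self hδ, compatRel_comm,
      hΔ.compatRel_neg_pos' hW hc' hδ (hΔ.simple_pos hδ)]
  -- This is the case where σ turns the support rule into noncrossing: σ(-δ) = δ, and δ and -δ have
  -- the same reflection.
  · have h := hΔ.noncrossing_rotate hδ (reflProd (δ :: l)) δ β
    rw [refl_self, refl_neg] at h
    rw [hae, hΔ.sigma_neg_self, hΔ.sigma_pos δ hβ,
      hΔ.compatRel_pos_pos hc' (hΔ.simple_pos hδ) (hΔ.refl_pos hδ hβ hβe), h,
      hΔ.inner_refl_self hδ, neg_nonneg, hΔ.noncrossing_head_and_inner_nonpos_iff hW hl hβ hβe]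
  · rw [hβe, hΔ.sigma_self hδ, hΔ.sigma_neg ha hae]
    exact iff_of_true (Submodule.subset_span ⟨hδ, Ne.symm hae⟩)
      (hΔ.compatRel_neg_neg hc' (by rwa [neg_neg]) (by rwa [neg_neg]))
  · rw [hΔ.sigma_neg ha hae, hΔ.sigma_pos δ hβ,
      hΔ.compatRel_neg_pos' hW hc' ha (hΔ.refl_pos hδ hβ hβe), hΔ.refl_mem_span_iff hδ ha hae hβ.1]

/-- Here σ(δ) = -δ. The span criterion for noncrossing with δ is symmetric in β and sβ, while the
inner product changes sign, so the support condition applies to sβ. -/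
lemma compatRel_rotate_simple_pos (hW : IsFiniteReflectionGroup W) {δ β : V} {l : List V}
    (hl : IsCoxeterWord Δ (δ :: l)) (hβ : β ∈ positiveRoots W Δ) :
    CompatRel W Δ (reflProd (δ :: l)) δ β ↔
      CompatRel W Δ (refl δ * reflProd (δ :: l) * refl δ) (sigma Δ δ δ) (sigma Δ δ β) := by
  have hδ : δ ∈ Δ := (hl.2 δ).1 List.mem_cons_self
  have hc := hΔ.isStandardCoxeter_reflProd hl
  have hc' : IsStandardCoxeter Δ (refl δ * reflProd (δ :: l) * refl δ) := by
    rw [hΔ.rotate_mul]; exact hΔ.isStandardCoxeter_reflProd hl.rotate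
  rw [hΔ.compatRel_pos_pos hc (hΔ.simple_pos hδ) hβ]
  by_cases hβe : β = δ
  · rw [hβe, hΔ.sigma_self hδ]
    exact iff_of_true ⟨noncrossing_self _ _, real_inner_self_nonneg⟩
      (hΔ.compatRel_neg_neg hc' (by rwa [neg_neg]) (by rwa [neg_neg]))
  · have hβ' := hΔ.refl_pos hδ hβ hβe
    have hβe' : refl δ β ≠ δ := by
      intro h
      have h1 := hΔ.neg_notMem_pos hβ
      rw [← refl_refl δ β, h, refl_self, neg_neg] at h1
      exact h1 (hΔ.simple_pos hδ)
    rw [hΔ.sigma_self hδ, hΔ.sigma_pos δ hβ, hΔ.compatRel_neg_pos' hW hc' hδ hβ',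
      ← hΔ.noncrossing_head_and_inner_nonpos_iff hW hl hβ' hβe', hΔ.inner_refl_self hδ,
      neg_nonpos, hΔ.noncrossing_head_iff hW hl hβ hβe, hΔ.noncrossing_head_iff hW hl hβ' hβe',
      refl_refl, or_comm]

lemma compatRel_rotate_pos_pos (hW : IsFiniteReflectionGroup W) {δ α β : V} {l : List V}
    (hl : IsCoxeterWord Δ (δ :: l)) (hα : α ∈ positiveRoots W Δ) (hβ : β ∈ positiveRoots W Δ) :
    CompatRel W Δ (reflProd (δ :: l)) α β ↔
      CompatRel W Δ (refl δ * reflProd (δ :: l) * refl δ) (sigma Δ δ α) (sigma Δ δ β) := by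
  have hδ : δ ∈ Δ := (hl.2 δ).1 List.mem_cons_self
  have hc := hΔ.isStandardCoxeter_reflProd hl
  have hc' : IsStandardCoxeter Δ (refl δ * reflProd (δ :: l) * refl δ) := by
    rw [hΔ.rotate_mul]; exact hΔ.isStandardCoxeter_reflProd hl.rotate
  by_cases hαe : α = δ
  · rw [hαe]
    exact hΔ.compatRel_rotate_simple_pos hW hl hβ
  by_cases hβe : β = δ
  · rw [hβe, compatRel_comm, hΔ.compatRel_rotate_simple_pos hW hl hα, compatRel_comm]
  rw [hΔ.compatRel_pos_pos hc hα hβ, hΔ.sigma_pos δ hα, hΔ.sigma_pos δ hβ,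
    hΔ.compatRel_pos_pos hc' (hΔ.refl_pos hδ hα hαe) (hΔ.refl_pos hδ hβ hβe),
    hΔ.noncrossing_rotate hδ, LinearIsometryEquiv.inner_map_map]

/-! ### Existence and uniqueness of the family -/

theorem isCompatFamily_compatRel (hW : IsFiniteReflectionGroup W) :
    IsCompatFamily W Δ (CompatRel W Δ) where
  dom _ _ _ h := ⟨h.1, h.2.1, h.2.2.1⟩
  symm _ _ _ h := h.symm
  neg_neg _ hc _ _ hα hβ := hΔ.compatRel_neg_neg hc hα hβ
  neg_pos _ hc _ _ hα hβ := hΔ.compatRel_neg_pos hc hα hβ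
  rotate c hc δ hδ hdesc α hα β hβ := by
    obtain ⟨l, hl, rfl⟩ := hΔ.exists_word_of_isLeftDescent hc hδ hdesc
    rcases hα with hα | hα <;> rcases hβ with hβ | hβ
    · have hc' : IsStandardCoxeter Δ (refl δ * reflProd (δ :: l) * refl δ) := by
        rw [hΔ.rotate_mul]; exact hΔ.isStandardCoxeter_reflProd hl.rotate
      simpa only [neg_neg] using hΔ.compatRel_rotate_neg_neg hW hc hc' hδ hα hβ
    · simpa only [neg_neg] using hΔ.compatRel_rotate_neg_pos hW hl hα hβ
    · rw [compatRel_comm, compatRel_comm (α := sigma Δ δ α)]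
      simpa only [neg_neg] using hΔ.compatRel_rotate_neg_pos hW hl hβ hα
    · exact hΔ.compatRel_rotate_pos_pos hW hl hα hβ

theorem isCompatFamily_unique (hW : IsFiniteReflectionGroup W)
    {R R' : (V ≃ₗᵢ[ℝ] V) → V → V → Prop} (hR : IsCompatFamily W Δ R)
    (hR' : IsCompatFamily W Δ R') : R = R' := by
  have neg : ∀ c, IsStandardCoxeter Δ c → ∀ α β, -α ∈ Δ → β ∈ almostPositiveRoots W Δ →
      (R c α β ↔ R' c α β) := by
    rintro c hc α β hα (hβ | hβ)
    · exact iff_of_true (hR.neg_neg c hc α β hα hβ) (hR'.neg_neg c hc α β hα hβ)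
    · rw [hR.neg_pos c hc α β hα hβ, hR'.neg_pos c hc α β hα hβ]
  have rot : ∀ l δ α β, IsCoxeterWord Δ (δ :: l) → α ∈ almostPositiveRoots W Δ →
      β ∈ almostPositiveRoots W Δ →
      (R (reflProd (l ++ [δ])) (sigma Δ δ α) (sigma Δ δ β) ↔
        R' (reflProd (l ++ [δ])) (sigma Δ δ α) (sigma Δ δ β)) →
      (R (reflProd (δ :: l)) α β ↔ R' (reflProd (δ :: l)) α β) := by
    intro l δ α β hl hα hβ h
    have hδ : δ ∈ Δ := (hl.2 δ).1 List.mem_cons_self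
    have hc := hΔ.isStandardCoxeter_reflProd hl
    have hd := hΔ.isLeftDescent_head hl
    rwa [hR.rotate _ hc δ hδ hd α hα β hβ, hR'.rotate _ hc δ hδ hd α hα β hβ, hΔ.rotate_mul]
  have pos : ∀ l α, IsCoxeterWord Δ l → α ∈ positiveRoots W Δ →
      ∀ β ∈ almostPositiveRoots W Δ, (R (reflProd l) α β ↔ R' (reflProd l) α β) := by
    intro l α hl hα
    refine hΔ.rotation_induction hW subset_rfl
      (Q := fun l α => ∀ β ∈ almostPositiveRoots W Δ,
        (R (reflProd l) α β ↔ R' (reflProd l) α β)) ?_ ?_ l α hl hα (hΔ.mem_span hα.1)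
    -- Rotating the first letter α sends it to -α, where both families obey the same explicit rules.
    · intro l α h β hβ
      have hα : α ∈ Δ := (h.2 α).1 List.mem_cons_self
      refine rot l α α β h (Or.inr (hΔ.simple_pos hα)) hβ (neg _
        (hΔ.isStandardCoxeter_reflProd h.rotate) _ _ ?_ (hΔ.sigma_mem hα hβ))
      rwa [hΔ.sigma_self hα, neg_neg]
    · intro l δ α h hα hne ih β hβ
      have hδ : δ ∈ Δ := (h.2 δ).1 List.mem_cons_self
      refine rot l δ α β h (Or.inr hα) hβ ?_
      rw [hΔ.sigma_pos δ hα]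
      exact ih _ (hΔ.sigma_mem hδ hβ)
  have all : ∀ c, IsStandardCoxeter Δ c → ∀ α ∈ almostPositiveRoots W Δ,
      ∀ β ∈ almostPositiveRoots W Δ, (R c α β ↔ R' c α β) := by
    rintro c hc α (hα | hα) β hβ
    · exact neg c hc α β hα hβ
    · obtain ⟨l, hl, rfl⟩ := hΔ.isStandardCoxeter_iff.1 hc
      exact pos l α hl hα β hβ
  -- Equality of functions also concerns arguments outside the intended domain; `dom` makes both
  -- relations false there.
  funext c α β
  refine propext ⟨fun h => ?_, fun h => ?_⟩
  · obtain ⟨h1, h2, h3⟩ := hR.dom c α β h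
    exact (all c h1 α h2 β h3).1 h
  · obtain ⟨h1, h2, h3⟩ := hR'.dom c α β h
    exact (all c h1 α h2 β h3).2 h

lemma compat_eq_compatRel (hW : IsFiniteReflectionGroup W) : Compat W Δ = CompatRel W Δ :=
  hΔ.isCompatFamily_unique hW
    (Classical.epsilon_spec ⟨_, hΔ.isCompatFamily_compatRel hW⟩) (hΔ.isCompatFamily_compatRel hW)

end IsSimpleSystem

end coxeter

end CoxeterCluster

theorem mainTheorem11 {V : Type*} [NormedAddCommGroup V] [InnerProductSpace ℝ V]
    [FiniteDimensional ℝ V] (W : Subgroup (V ≃ₗᵢ[ℝ] V))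
    (hW : CoxeterCluster.IsFiniteReflectionGroup W)
    (Δ : Set V) (hΔ : CoxeterCluster.IsSimpleSystem W Δ) :
    (∃! R : (V ≃ₗᵢ[ℝ] V) → V → V → Prop, CoxeterCluster.IsCompatFamily W Δ R) ∧
    ∀ c : V ≃ₗᵢ[ℝ] V, CoxeterCluster.IsStandardCoxeter Δ c →
      ∀ α ∈ CoxeterCluster.positiveRoots W Δ, ∀ β ∈ CoxeterCluster.positiveRoots W Δ,
        (CoxeterCluster.Compat W Δ c α β ↔
          CoxeterCluster.Noncrossing W c
            (CoxeterCluster.refl α) (CoxeterCluster.refl β) ∧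
          0 ≤ inner ℝ α β) := by
  refine ⟨⟨_, hΔ.isCompatFamily_compatRel hW, fun R hR =>
    hΔ.isCompatFamily_unique hW hR (hΔ.isCompatFamily_compatRel hW)⟩, ?_⟩
  intro c hc α hα β hβ
  rw [hΔ.compat_eq_compatRel hW]
  exact hΔ.compatRel_pos_pos hc hα hβ
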